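/- Let $K$ be a field of characteristic $0$. Let $\mathcal H_{\mathrm{CM}}$ be the Connes–Moscovici Hopf algebra: as an algebra it is the enveloping algebra of the Lie algebra with basis $Y, X, \delta_n$ ($n\ge 1$) and brackets $$[Y,X]=X,\quad [Y,\delta_n]=n\,\delta_n,\quad [\delta_n,\delta_m]=0,\quad [X,\delta_n]=\delta_{n+1},$$ and its coproduct $\Delta$ is the algebra morphism determined by $$\Delta(Y)=Y\otimes 1+1\otimes Y,\quad \Delta(X)=X\otimes 1+1\otimes X+\delta_1\otimes Y,\quad \Delta(\delta_1)=\delta_1\otimes 1+1\otimes\delta_1 .$$ Let $\mathcal H^1_{\mathrm{CM}}\subset\mathcal H_{\mathrm{CM}}$ be the Hopf subalgebra generated by the $\delta_n$, $n\ge1$. Then, for every $n\ge 1$, in $\mathcal H^1_{\mathrm{CM}}\otimes\mathcal H^1_{\mathrm{CM}}$, $$\Delta(\delta_n)=\delta_n\otimes 1+1\otimes\delta_n+\sum_{\substack{s\ge 1,\ n_1,\dots,n_{s+1}\ge 1\\ n_1+\dots+n_{s+1}=n}}\frac{n!}{n_1!\cdots n_{s+1}!}\,\alpha^{n_1,\dots,n_s}_{n_{s+1}}\;\delta_{n_1}\cdots\delta_{n_s}\otimes\delta_{n_{s+1}}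 .$$ Here, for a tuple $\mathbf n=(n_1,\dots,n_s)$ of positive integers ($s\ge 1$) write $l(\mathbf n)=s$ and $\|\mathbf n\|=n_1+\dots+n_s$; then for $m\ge 1$ $$\alpha^{\mathbf n}_m=\sum_{t=1}^{l(\mathbf n)}\binom mt\sum_{\mathbf n^1\cdots\mathbf n^t=\mathbf n}A(\mathbf n^1,\dots,\mathbf n^t),\qquad A(\mathbf n^1,\dots,\mathbf n^t)=\frac{1}{l(\mathbf n^1)!\cdots l(\mathbf n^t)!}\prod_{i=1}^t\frac{1}{\|\mathbf n^i\|+1},$$ where the inner sum is over all $t$-tuples of non-empty tuples $\mathbf n^1,\dots,\mathbf n^t$ whose concatenation is $\mathbf n$, and $\binom mt=0$ if $t>m$. -/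

import Mathlib

open scoped TensorProduct Nat

namespace ConnesMoscovici

section LieAlgebra

/-- The vector space with basis `Y`, `X`, `δ₁, δ₂, …`: the triple `(y, x, d)` stands for
`y Y + x X + ∑ n, d n δ_n`. -/
structure CMLie (K : Type*) [Field K] where
  y : K
  x : K
  d : ℕ+ →₀ K

variable (K : Type*) [Field K]

/-- The coordinates of an element of `CMLie K`. -/
def CMLie.coords : CMLie K ≃ K × K × (ℕ+ →₀ K) where
  toFun a := (a.y, a.x, a.d)
  invFun p := ⟨p.1, p.2.1, p.2.2⟩
  left_inv _ := rfl
  right_inv _ := rfl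

noncomputable instance : AddCommGroup (CMLie K) := (CMLie.coords K).addCommGroup

noncomputable instance : Module K (CMLie K) := (CMLie.coords K).module K

/-- The action of `Y` on the span of the `δ_n`: `δ_n ↦ n δ_n`. -/
noncomputable def actY : (ℕ+ →₀ K) →ₗ[K] (ℕ+ →₀ K) :=
  Finsupp.lsum K fun n : ℕ+ => ((n : ℕ) : K) • Finsupp.lsingle n

/-- The action of `X` on the span of the `δ_n`: `δ_n ↦ δ_{n+1}`. -/
noncomputable def actX : (ℕ+ →₀ K) →ₗ[K] (ℕ+ →₀ K) :=
  Finsupp.lmapDomain K K fun n : ℕ+ => n + 1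

theorem actY_single (n : ℕ+) (a : K) :
    actY K (Finsupp.single n a) = Finsupp.single n ((n : ℕ) * a) := by
  simp [actY]

theorem actX_single (n : ℕ+) (a : K) :
    actX K (Finsupp.single n a) = Finsupp.single (n + 1) a := by
  simp [actX]

theorem actY_actX (d : ℕ+ →₀ K) :
    actY K (actX K d) = actX K d + actX K (actY K d) := by
  induction d using Finsupp.induction_linear with
  | zero => simp
  | add f g hf hg => simp only [map_add, hf, hg]; abel
  | single n a =>
    simp only [actX_single, actY_single, ← Finsupp.single_add]
    congr 1
    push_cast
    ring

variable {K}

@[ext] theorem CMLie.ext' {a b : CMLie K} (hy : a.y = b.y) (hx : a.x = b.x) (hd : a.d = b.d) :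
    a = b := by
  cases a; cases b; simp_all

@[simp] theorem CMLie.zero_y : (0 : CMLie K).y = 0 := rfl
@[simp] theorem CMLie.zero_x : (0 : CMLie K).x = 0 := rfl
@[simp] theorem CMLie.zero_d : (0 : CMLie K).d = 0 := rfl
@[simp] theorem CMLie.add_y (a b : CMLie K) : (a + b).y = a.y + b.y := rfl
@[simp] theorem CMLie.add_x (a b : CMLie K) : (a + b).x = a.x + b.x := rfl
@[simp] theorem CMLie.add_d (a b : CMLie K) : (a + b).d = a.d + b.d := rfl
@[simp] theorem CMLie.smul_y (r : K) (a : CMLie K) : (r • a).y = r * a.y := rfl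
@[simp] theorem CMLie.smul_x (r : K) (a : CMLie K) : (r • a).x = r * a.x := rfl
@[simp] theorem CMLie.smul_d (r : K) (a : CMLie K) : (r • a).d = r • a.d := rfl

/-- The bilinear alternating bracket with `[Y, X] = X`, `[Y, δ_n] = n δ_n`, `[X, δ_n] = δ_{n+1}`,
`[δ_n, δ_m] = 0`. -/
noncomputable instance : Bracket (CMLie K) (CMLie K) where
  bracket a b :=
    { y := 0
      x := a.y * b.x - b.y * a.x
      d := a.y • actY K b.d - b.y • actY K a.d + a.x • actX K b.d - b.x • actX K a.d }

@[simp] theorem CMLie.lie_y (a b : CMLie K) : ⁅a, b⁆.y = 0 := rfl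
@[simp] theorem CMLie.lie_x (a b : CMLie K) : ⁅a, b⁆.x = a.y * b.x - b.y * a.x := rfl
@[simp] theorem CMLie.lie_d (a b : CMLie K) : ⁅a, b⁆.d =
    a.y • actY K b.d - b.y • actY K a.d + a.x • actX K b.d - b.x • actX K a.d := rfl

noncomputable instance : LieRing (CMLie K) where
  add_lie a b c := by
    ext1
    · simp
    · simp; ring
    · simp only [CMLie.lie_d, CMLie.add_d, CMLie.add_y, CMLie.add_x, map_add]; module
  lie_add a b c := by
    ext1
    · simp
    · simp; ring
    · simp only [CMLie.lie_d, CMLie.add_d, CMLie.add_y, CMLie.add_x, map_add]; module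
  lie_self a := by
    ext1
    · simp
    · simp
    · simp
  leibniz_lie a b c := by
    ext1
    · simp
    · simp; ring
    · simp only [CMLie.lie_d, CMLie.lie_x, CMLie.lie_y, CMLie.add_d, map_add, map_sub, map_smul,
        actY_actX]
      module

noncomputable instance : LieAlgebra K (CMLie K) where
  lie_smul r a b := by
    ext1
    · simp
    · simp; ring
    · simp only [CMLie.lie_d, CMLie.smul_d, CMLie.smul_y, CMLie.smul_x, map_smul]; module

variable (K)

/-- The basis vector `Y`. -/
def CMLie.Y : CMLie K := ⟨1, 0, 0⟩

/-- The basis vector `X`. -/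
def CMLie.X : CMLie K := ⟨0, 1, 0⟩

/-- The basis vector `δ_n`, `n ≥ 1`. -/
noncomputable def CMLie.delta (n : ℕ+) : CMLie K := ⟨0, 0, Finsupp.single n 1⟩

theorem CMLie.lie_Y_X : ⁅CMLie.Y K, CMLie.X K⁆ = CMLie.X K := by
  ext1 <;> simp [CMLie.Y, CMLie.X]

theorem CMLie.lie_Y_delta (n : ℕ+) :
    ⁅CMLie.Y K, CMLie.delta K n⁆ = ((n : ℕ) : K) • CMLie.delta K n := by
  ext1 <;> simp [CMLie.Y, CMLie.delta, actY_single]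

theorem CMLie.lie_X_delta (n : ℕ+) :
    ⁅CMLie.X K, CMLie.delta K n⁆ = CMLie.delta K (n + 1) := by
  ext1 <;> simp [CMLie.X, CMLie.delta, actX_single]

theorem CMLie.lie_delta_delta (n m : ℕ+) :
    ⁅CMLie.delta K n, CMLie.delta K m⁆ = 0 := by
  ext1 <;> simp [CMLie.delta]

end LieAlgebra

section HopfAlgebra

attribute [local instance 100] LieRing.ofAssociativeRing

variable (K : Type*) [Field K]

/-- The Connes–Moscovici algebra `H_CM`, as an algebra. -/
abbrev HCM : Type _ := UniversalEnvelopingAlgebra K (CMLie K)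

/-- `Y` in `H_CM`. -/
noncomputable def HCM.Y : HCM K := UniversalEnvelopingAlgebra.ι K (CMLie.Y K)

/-- `X` in `H_CM`. -/
noncomputable def HCM.X : HCM K := UniversalEnvelopingAlgebra.ι K (CMLie.X K)

/-- `δ_n` in `H_CM`, for `n ≥ 1`; the value at `n = 0` is never used. -/
noncomputable def HCM.delta (n : ℕ) : HCM K :=
  UniversalEnvelopingAlgebra.ι K (CMLie.delta K n.toPNat')

theorem HCM.Y_mul_X : HCM.Y K * HCM.X K = HCM.X K * HCM.Y K + HCM.X K := by
  have h := (UniversalEnvelopingAlgebra.ι K (L := CMLie K)).map_lie (CMLie.Y K) (CMLie.X K)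
  rw [CMLie.lie_Y_X, LieRing.of_associative_ring_bracket] at h
  rw [HCM.X, HCM.Y]
  nth_rw 3 [h]
  abel

theorem HCM.Y_mul_delta (n : ℕ) (hn : 1 ≤ n) :
    HCM.Y K * HCM.delta K n = HCM.delta K n * HCM.Y K + (n : K) • HCM.delta K n := by
  have h := (UniversalEnvelopingAlgebra.ι K (L := CMLie K)).map_lie (CMLie.Y K)
    (CMLie.delta K n.toPNat')
  rw [CMLie.lie_Y_delta, LieRing.of_associative_ring_bracket, map_smul,
    PNat.toPNat'_coe hn] at h
  rw [HCM.delta, HCM.Y, h]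
  abel

theorem HCM.X_mul_delta (n : ℕ) (hn : 1 ≤ n) :
    HCM.X K * HCM.delta K n = HCM.delta K n * HCM.X K + HCM.delta K (n + 1) := by
  have h := (UniversalEnvelopingAlgebra.ι K (L := CMLie K)).map_lie (CMLie.X K)
    (CMLie.delta K n.toPNat')
  have e : n.toPNat' + 1 = (n + 1).toPNat' := by
    apply PNat.eq
    simp [PNat.toPNat'_coe hn]
  rw [CMLie.lie_X_delta, LieRing.of_associative_ring_bracket, e] at h
  rw [HCM.delta, HCM.X, HCM.delta, h]
  abel

theorem HCM.delta_mul_delta (n m : ℕ) :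
    HCM.delta K n * HCM.delta K m = HCM.delta K m * HCM.delta K n := by
  have h := (UniversalEnvelopingAlgebra.ι K (L := CMLie K)).map_lie (CMLie.delta K n.toPNat')
    (CMLie.delta K m.toPNat')
  rw [CMLie.lie_delta_delta, LieRing.of_associative_ring_bracket, map_zero] at h
  exact sub_eq_zero.mp h.symm

/-- The subalgebra `H¹_CM` of `H_CM` generated by the `δ_n`, `n ≥ 1`. -/
noncomputable def H1 : Subalgebra K (HCM K) :=
  Algebra.adjoin K {h | ∃ n : ℕ, 1 ≤ n ∧ h = HCM.delta K n}

theorem HCM.delta_mem_H1 (n : ℕ) (hn : 1 ≤ n) : HCM.delta K n ∈ H1 K :=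
  Algebra.subset_adjoin ⟨n, hn, rfl⟩

theorem HCM.delta_mem_H1' (n : ℕ) : HCM.delta K n ∈ H1 K := by
  rcases Nat.eq_zero_or_pos n with rfl | hn
  · exact HCM.delta_mem_H1 K 1 le_rfl
  · exact HCM.delta_mem_H1 K n hn

/-- `δ_n` in `H¹_CM`, for `n ≥ 1`; the value at `n = 0` is never used. -/
noncomputable def H1.delta (n : ℕ) : H1 K := ⟨HCM.delta K n, HCM.delta_mem_H1' K n⟩

theorem H1_mul_comm (a b : HCM K) (ha : a ∈ H1 K) (hb : b ∈ H1 K) : a * b = b * a := by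
  refine Algebra.commute_of_mem_adjoin_of_forall_mem_commute (R := K) hb ?_
  rintro _ ⟨m, -, rfl⟩
  refine (Algebra.commute_of_mem_adjoin_of_forall_mem_commute (R := K) ha ?_).symm
  rintro _ ⟨n, -, rfl⟩
  exact HCM.delta_mul_delta K m n

theorem HCM.commutator_mem_H1 (z a : HCM K)
    (hz : ∀ n : ℕ, 1 ≤ n → z * HCM.delta K n - HCM.delta K n * z ∈ H1 K) (ha : a ∈ H1 K) :
    z * a - a * z ∈ H1 K := by
  induction ha using Algebra.adjoin_induction with
  | mem x hx => obtain ⟨n, hn, rfl⟩ := hx; exact hz n hn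
  | algebraMap r => simp [Algebra.commutes r z]
  | add x y _ _ hx hy =>
    have : z * (x + y) - (x + y) * z = (z * x - x * z) + (z * y - y * z) := by noncomm_ring
    rw [this]
    exact add_mem hx hy
  | mul x y hx' hy' hx hy =>
    have : z * (x * y) - (x * y) * z = (z * x - x * z) * y + x * (z * y - y * z) := by
      noncomm_ring
    rw [this]
    exact add_mem (mul_mem hx hy') (mul_mem hx' hy)

theorem HCM.commutator_Y_mem_H1 (a : HCM K) (ha : a ∈ H1 K) :
    HCM.Y K * a - a * HCM.Y K ∈ H1 K := by
  refine HCM.commutator_mem_H1 K _ a (fun n hn => ?_) ha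
  rw [HCM.Y_mul_delta K n hn, add_sub_cancel_left]
  exact Subalgebra.smul_mem _ (HCM.delta_mem_H1 K n hn) _

theorem HCM.commutator_X_mem_H1 (a : HCM K) (ha : a ∈ H1 K) :
    HCM.X K * a - a * HCM.X K ∈ H1 K := by
  refine HCM.commutator_mem_H1 K _ a (fun n hn => ?_) ha
  rw [HCM.X_mul_delta K n hn, add_sub_cancel_left]
  exact HCM.delta_mem_H1 K _ (by omega)

/-- `Δ(Y) = Y ⊗ 1 + 1 ⊗ Y`. -/
noncomputable def comulY : HCM K ⊗[K] HCM K := HCM.Y K ⊗ₜ 1 + 1 ⊗ₜ HCM.Y K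

/-- `Δ(X) = X ⊗ 1 + 1 ⊗ X + δ₁ ⊗ Y`. -/
noncomputable def comulX : HCM K ⊗[K] HCM K :=
  HCM.X K ⊗ₜ 1 + 1 ⊗ₜ HCM.X K + HCM.delta K 1 ⊗ₜ HCM.Y K

/-- The value of `Δ(δ_{n+1})`, by recursion from `Δ(δ₁) = δ₁ ⊗ 1 + 1 ⊗ δ₁` and
`δ_{n+1} = [X, δ_n]`. -/
noncomputable def comulDelta : ℕ → HCM K ⊗[K] HCM K
  | 0 => HCM.delta K 1 ⊗ₜ 1 + 1 ⊗ₜ HCM.delta K 1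
  | n + 1 => comulX K * comulDelta n - comulDelta n * comulX K

/-- The natural map `H¹_CM ⊗ H¹_CM → H_CM ⊗ H_CM`. -/
noncomputable def inclTensor : H1 K ⊗[K] H1 K →ₐ[K] HCM K ⊗[K] HCM K :=
  Algebra.TensorProduct.map (H1 K).val (H1 K).val

theorem inclTensor_tmul (a b : H1 K) :
    inclTensor K (a ⊗ₜ b) = (a : HCM K) ⊗ₜ[K] (b : HCM K) := rfl

theorem inclTensor_injective : Function.Injective (inclTensor K) :=
  TensorProduct.map_injective_of_flat_flat (H1 K).val.toLinearMap (H1 K).val.toLinearMap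
    Subtype.val_injective Subtype.val_injective

theorem tmul_mem_range (a b : HCM K) (ha : a ∈ H1 K) (hb : b ∈ H1 K) :
    a ⊗ₜ[K] b ∈ (inclTensor K).range :=
  ⟨(⟨a, ha⟩ : H1 K) ⊗ₜ (⟨b, hb⟩ : H1 K), rfl⟩

theorem range_mul_comm (u v : HCM K ⊗[K] HCM K) (hu : u ∈ (inclTensor K).range)
    (hv : v ∈ (inclTensor K).range) : u * v = v * u := by
  obtain ⟨p, rfl⟩ := hu
  obtain ⟨q, rfl⟩ := hv
  change inclTensor K p * inclTensor K q = inclTensor K q * inclTensor K p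
  induction p using TensorProduct.induction_on with
  | zero => simp
  | add p₁ p₂ h₁ h₂ => rw [map_add, add_mul, mul_add, h₁, h₂]
  | tmul a b =>
    induction q using TensorProduct.induction_on with
    | zero => simp
    | add q₁ q₂ h₁ h₂ => rw [map_add, add_mul, mul_add, h₁, h₂]
    | tmul c d =>
      rw [inclTensor_tmul, inclTensor_tmul, Algebra.TensorProduct.tmul_mul_tmul,
        Algebra.TensorProduct.tmul_mul_tmul, H1_mul_comm K a c a.2 c.2, H1_mul_comm K b d b.2 d.2]

theorem comulX_commutator_mem_range (u : HCM K ⊗[K] HCM K) (hu : u ∈ (inclTensor K).range) :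
    comulX K * u - u * comulX K ∈ (inclTensor K).range := by
  obtain ⟨p, rfl⟩ := hu
  change comulX K * inclTensor K p - inclTensor K p * comulX K ∈ _
  induction p using TensorProduct.induction_on with
  | zero => simp
  | add p₁ p₂ h₁ h₂ =>
    rw [map_add, add_mul, mul_add, add_sub_add_comm]
    exact add_mem h₁ h₂
  | tmul a b =>
    have h : comulX K * inclTensor K (a ⊗ₜ b) - inclTensor K (a ⊗ₜ b) * comulX K =
        (HCM.X K * a - a * HCM.X K) ⊗ₜ (b : HCM K) + (a : HCM K) ⊗ₜ (HCM.X K * b - b * HCM.X K)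
          + ((a : HCM K) * HCM.delta K 1) ⊗ₜ (HCM.Y K * b - b * HCM.Y K) := by
      rw [inclTensor_tmul, comulX]
      simp only [add_mul, mul_add, Algebra.TensorProduct.tmul_mul_tmul, one_mul, mul_one,
        TensorProduct.tmul_sub, TensorProduct.sub_tmul,
        H1_mul_comm K _ _ (HCM.delta_mem_H1' K 1) a.2]
      abel
    rw [h]
    refine add_mem (add_mem ?_ ?_) ?_
    · exact tmul_mem_range K _ _ (HCM.commutator_X_mem_H1 K a a.2) b.2
    · exact tmul_mem_range K _ _ a.2 (HCM.commutator_X_mem_H1 K b b.2)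
    · exact tmul_mem_range K _ _ (mul_mem a.2 (HCM.delta_mem_H1' K 1))
        (HCM.commutator_Y_mem_H1 K b b.2)

theorem comulDelta_mem_range (n : ℕ) : comulDelta K n ∈ (inclTensor K).range := by
  induction n with
  | zero =>
    exact add_mem (tmul_mem_range K _ _ (HCM.delta_mem_H1' K 1) (one_mem _))
      (tmul_mem_range K _ _ (one_mem _) (HCM.delta_mem_H1' K 1))
  | succ n ih => exact comulX_commutator_mem_range K _ ih

theorem comulDelta_mul_comm (m n : ℕ) :
    comulDelta K m * comulDelta K n = comulDelta K n * comulDelta K m :=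
  range_mul_comm K _ _ (comulDelta_mem_range K m) (comulDelta_mem_range K n)

theorem comulY_lie_comulX : ⁅comulY K, comulX K⁆ = comulX K := by
  rw [LieRing.of_associative_ring_bracket, comulY, comulX]
  simp only [add_mul, mul_add, Algebra.TensorProduct.tmul_mul_tmul, one_mul, mul_one,
    HCM.Y_mul_X, HCM.Y_mul_delta K 1 le_rfl, TensorProduct.tmul_add, TensorProduct.add_tmul,
    Nat.cast_one, one_smul]
  abel

theorem comulY_lie_comulDelta (n : ℕ) :
    ⁅comulY K, comulDelta K n⁆ = ((n + 1 : ℕ) : K) • comulDelta K n := by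
  induction n with
  | zero =>
    rw [LieRing.of_associative_ring_bracket, comulY, comulDelta]
    simp only [add_mul, mul_add, Algebra.TensorProduct.tmul_mul_tmul, one_mul, mul_one,
      HCM.Y_mul_delta K 1 le_rfl, TensorProduct.tmul_add, TensorProduct.add_tmul,
      Nat.cast_one, one_smul, zero_add]
    abel
  | succ n ih =>
    have h : comulDelta K (n + 1) = ⁅comulX K, comulDelta K n⁆ := rfl
    rw [h, leibniz_lie, comulY_lie_comulX, ih, lie_smul]
    push_cast
    module

/-- The linear map `CMLie K → H_CM ⊗ H_CM` with the prescribed values on the basis. -/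
noncomputable def comulLin : CMLie K →ₗ[K] HCM K ⊗[K] HCM K where
  toFun a := a.y • comulY K + a.x • comulX K
    + Finsupp.linearCombination K (fun n : ℕ+ => comulDelta K n.natPred) a.d
  map_add' a b := by
    simp only [CMLie.add_y, CMLie.add_x, CMLie.add_d, map_add]
    module
  map_smul' r a := by
    simp only [CMLie.smul_y, CMLie.smul_x, CMLie.smul_d, map_smul, RingHom.id_apply]
    module

theorem comulY_lie_linearCombination (d : ℕ+ →₀ K) :
    ⁅comulY K, Finsupp.linearCombination K (fun n : ℕ+ => comulDelta K n.natPred) d⁆ =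
      Finsupp.linearCombination K (fun n : ℕ+ => comulDelta K n.natPred) (actY K d) := by
  induction d using Finsupp.induction_linear with
  | zero => simp
  | add f g hf hg => simp only [map_add, lie_add, hf, hg]
  | single n a =>
    rw [actY_single, Finsupp.linearCombination_single, Finsupp.linearCombination_single,
      lie_smul, comulY_lie_comulDelta, smul_smul, PNat.natPred_add_one, mul_comm]

theorem comulX_lie_linearCombination (d : ℕ+ →₀ K) :
    ⁅comulX K, Finsupp.linearCombination K (fun n : ℕ+ => comulDelta K n.natPred) d⁆ =
      Finsupp.linearCombination K (fun n : ℕ+ => comulDelta K n.natPred) (actX K d) := by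
  induction d using Finsupp.induction_linear with
  | zero => simp
  | add f g hf hg => simp only [map_add, lie_add, hf, hg]
  | single n a =>
    have h : (n + 1).natPred = n.natPred + 1 := by
      have := n.pos
      simp only [PNat.natPred, PNat.add_coe, PNat.one_coe]
      omega
    rw [actX_single, Finsupp.linearCombination_single, Finsupp.linearCombination_single,
      lie_smul, h]
    rfl

theorem linearCombination_lie_linearCombination (d e : ℕ+ →₀ K) :
    ⁅Finsupp.linearCombination K (fun n : ℕ+ => comulDelta K n.natPred) d,
      Finsupp.linearCombination K (fun n : ℕ+ => comulDelta K n.natPred) e⁆ = 0 := by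
  induction d using Finsupp.induction_linear with
  | zero => simp
  | add f g hf hg => simp only [map_add, add_lie, hf, hg, add_zero]
  | single n a =>
    induction e using Finsupp.induction_linear with
    | zero => simp
    | add f g hf hg => simp only [map_add, lie_add, hf, hg, add_zero]
    | single m b =>
      rw [Finsupp.linearCombination_single, Finsupp.linearCombination_single, smul_lie, lie_smul,
        LieRing.of_associative_ring_bracket, comulDelta_mul_comm, sub_self, smul_zero, smul_zero]

/-- The map `comulLin` is a morphism of Lie algebras. -/
noncomputable def comulLie : CMLie K →ₗ⁅K⁆ HCM K ⊗[K] HCM K where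
  __ := comulLin K
  map_lie' := by
    intro a b
    have hYX := comulY_lie_comulX K
    have hXY : ⁅comulX K, comulY K⁆ = -comulX K := by rw [← lie_skew, hYX]
    have hDY (d : ℕ+ →₀ K) :=
      (lie_skew (Finsupp.linearCombination K (fun n : ℕ+ => comulDelta K n.natPred) d)
        (comulY K)).symm.trans (congrArg Neg.neg (comulY_lie_linearCombination K d))
    have hDX (d : ℕ+ →₀ K) :=
      (lie_skew (Finsupp.linearCombination K (fun n : ℕ+ => comulDelta K n.natPred) d)
        (comulX K)).symm.trans (congrArg Neg.neg (comulX_lie_linearCombination K d))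
    change (⁅a, b⁆ : CMLie K).y • comulY K + (⁅a, b⁆ : CMLie K).x • comulX K
      + Finsupp.linearCombination K (fun n : ℕ+ => comulDelta K n.natPred) (⁅a, b⁆ : CMLie K).d =
      ⁅a.y • comulY K + a.x • comulX K
        + Finsupp.linearCombination K (fun n : ℕ+ => comulDelta K n.natPred) a.d,
      b.y • comulY K + b.x • comulX K
        + Finsupp.linearCombination K (fun n : ℕ+ => comulDelta K n.natPred) b.d⁆
    simp only [CMLie.lie_y, CMLie.lie_x, CMLie.lie_d, map_add, map_sub, map_smul, add_lie, lie_add,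
      smul_lie, lie_smul, lie_self, hYX, hXY, hDY, hDX, comulY_lie_linearCombination,
      comulX_lie_linearCombination, linearCombination_lie_linearCombination]
    module

/-- The coproduct of `H_CM`: the algebra morphism `Δ` with `Δ(Y) = Y ⊗ 1 + 1 ⊗ Y`,
`Δ(X) = X ⊗ 1 + 1 ⊗ X + δ₁ ⊗ Y` and `Δ(δ₁) = δ₁ ⊗ 1 + 1 ⊗ δ₁`. -/
noncomputable def HCM.comul : HCM K →ₐ[K] HCM K ⊗[K] HCM K :=
  UniversalEnvelopingAlgebra.lift K (comulLie K)

theorem HCM.comul_Y : HCM.comul K (HCM.Y K) = HCM.Y K ⊗ₜ 1 + 1 ⊗ₜ HCM.Y K := by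
  rw [HCM.comul, HCM.Y, UniversalEnvelopingAlgebra.lift_ι_apply]
  change (1 : K) • comulY K + (0 : K) • comulX K + Finsupp.linearCombination K _ 0 = _
  simp [comulY, HCM.Y]

theorem HCM.comul_X : HCM.comul K (HCM.X K) =
    HCM.X K ⊗ₜ 1 + 1 ⊗ₜ HCM.X K + HCM.delta K 1 ⊗ₜ HCM.Y K := by
  rw [HCM.comul, HCM.X, UniversalEnvelopingAlgebra.lift_ι_apply]
  change (0 : K) • comulY K + (1 : K) • comulX K + Finsupp.linearCombination K _ 0 = _
  simp [comulX, HCM.X]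

theorem HCM.comul_delta (n : ℕ) : HCM.comul K (HCM.delta K n) = comulDelta K (n - 1) := by
  rw [HCM.comul, HCM.delta, UniversalEnvelopingAlgebra.lift_ι_apply]
  change (0 : K) • comulY K + (0 : K) • comulX K
    + Finsupp.linearCombination K _ (Finsupp.single n.toPNat' 1) = _
  rw [Finsupp.linearCombination_single]
  simp [Nat.toPNat', Nat.pred_eq_sub_one]

theorem HCM.comul_delta_one :
    HCM.comul K (HCM.delta K 1) = HCM.delta K 1 ⊗ₜ 1 + 1 ⊗ₜ HCM.delta K 1 :=
  HCM.comul_delta K 1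

theorem HCM.comul_mem_range (a : HCM K) (ha : a ∈ H1 K) :
    HCM.comul K a ∈ (inclTensor K).range := by
  have h : H1 K ≤ (inclTensor K).range.comap (HCM.comul K) := by
    refine Algebra.adjoin_le ?_
    rintro _ ⟨n, -, rfl⟩
    change HCM.comul K (HCM.delta K n) ∈ (inclTensor K).range
    rw [HCM.comul_delta]
    exact comulDelta_mem_range K _
  exact h ha

/-- The coproduct of the Hopf subalgebra `H¹_CM`: the restriction of the coproduct of `H_CM`,
which takes values in `H¹_CM ⊗ H¹_CM`, a subalgebra of `H_CM ⊗ H_CM`. -/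
noncomputable def H1.comul : H1 K →ₐ[K] H1 K ⊗[K] H1 K :=
  (AlgEquiv.ofInjective (inclTensor K) (inclTensor_injective K)).symm.toAlgHom.comp
    (((HCM.comul K).comp (H1 K).val).codRestrict (inclTensor K).range
      fun a => HCM.comul_mem_range K a a.2)

theorem inclTensor_comul (a : H1 K) : inclTensor K (H1.comul K a) = HCM.comul K a := by
  have h := congrArg Subtype.val
    ((AlgEquiv.ofInjective (inclTensor K) (inclTensor_injective K)).apply_symm_apply
      ((((HCM.comul K).comp (H1 K).val).codRestrict (inclTensor K).range
        fun a => HCM.comul_mem_range K a a.2) a))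
  exact h

end HopfAlgebra

section Coefficients

/-- The set `Split(𝐧)` of the sequences `(𝐧¹, …, 𝐧ᵗ)` of nonempty tuples whose concatenation
is `𝐧`. -/
def split (n : List ℕ) : Finset (List (List ℕ)) :=
  Finset.univ.image fun c : Composition n.length => n.splitWrtComposition c

theorem mem_split (n : List ℕ) (p : List (List ℕ)) :
    p ∈ split n ↔ p.flatten = n ∧ ∀ q ∈ p, q ≠ [] := by
  simp only [split, Finset.mem_image, Finset.mem_univ, true_and]
  constructor
  · rintro ⟨c, rfl⟩
    exact ⟨List.flatten_splitWrtComposition n c, fun q hq =>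
      List.length_pos_iff.mp (List.length_pos_of_mem_splitWrtComposition hq)⟩
  · rintro ⟨rfl, h⟩
    refine ⟨⟨p.map List.length, ?_, ?_⟩, ?_⟩
    · intro i hi
      obtain ⟨q, hq, rfl⟩ := List.mem_map.mp hi
      exact List.length_pos_iff.mpr (h q hq)
    · rw [List.length_flatten]
    · exact List.splitWrtComposition_flatten p _ rfl

/-- `A(𝐧¹, …, 𝐧ᵗ) = 1 / (l(𝐧¹)! ⋯ l(𝐧ᵗ)!) ∏ 1 / (‖𝐧ⁱ‖ + 1)`. -/
def coeffA (p : List (List ℕ)) : ℚ :=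
  1 / (p.map fun q => (q.length ! : ℚ)).prod * (p.map fun q => 1 / ((q.sum : ℚ) + 1)).prod

/-- `α^𝐧_m = ∑_{t = 1}^{l(𝐧)} C(m, t) ∑_{𝐧¹ ⋯ 𝐧ᵗ = 𝐧} A(𝐧¹, …, 𝐧ᵗ)`. -/
def alpha (n : List ℕ) (m : ℕ) : ℚ :=
  ∑ t ∈ Finset.Icc 1 n.length, (m.choose t : ℚ) * ∑ p ∈ split n with p.length = t, coeffA p

end Coefficients

end ConnesMoscovici

/-! Let `D = [X, ·]`, a derivation of the commutative algebra `H¹_CM` with `D δ_n = δ_{n+1}`. Write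
`Δ(δ_n) = δ_n ⊗ 1 + ∑ B_{n,m} ⊗ δ_m`, where `m` runs from `1` to `n`. Since `Δ(δ_{n+1}) = [Δ(X),
Δ(δ_n)]`, the three terms of `Δ(X)` give (`comulX_commutator_tmul_delta`) `B_{n+1,m} = D B_{n,m} +
B_{n,m-1} + m δ₁ B_{n,m}`.

This recursion is solved by a generating series. Let `φ = ∫ exp(∑ δ_k X^k / k!)` and let `T = d/dX -
D`, with `D` acting on coefficients. Then `T` sends the exponent to the constant `δ₁`, so it
multiplies the exponential by `δ₁`. As `T` commutes with `d/dX`, integration gives `T φ = 1 + δ₁ φ`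
(`derivativeSub_flowSeries`). Applying the derivation `T` to `φ^m / m!` shows that its coefficient
at `X^n / n!`, namely `bellCoeff`, satisfies the recursion (`bellCoeff_succ_succ`). In group terms,
`δ_k` is a Taylor coefficient of `log φ'`, and the coproduct is the chain rule `log (ψ ∘ φ)' = log
φ' + (log ψ') ∘ φ`.

The coefficients are then made explicit. With `φ = X (1 + u)`, the binomial theorem expands `φ^m` in
powers of `u`, and `u^t` is a sum over concatenations of `t` nonempty tuples with weights `A`
(`coeff_listSeries_pow`). This is `α`. -/

namespace ConnesMoscovici

/-! ### Power series indexed by compositions, and their powers -/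

section WeightedSeries

open PowerSeries

/-- The lists of positive integers with sum `k`. -/
def compositionLists (k : ℕ) : Finset (List ℕ) :=
  Finset.univ.image (Composition.blocks (n := k))

theorem mem_compositionLists {k : ℕ} {l : List ℕ} :
    l ∈ compositionLists k ↔ (∀ i ∈ l, 0 < i) ∧ l.sum = k := by
  simp only [compositionLists, Finset.mem_image, Finset.mem_univ, true_and]
  constructor
  · rintro ⟨c, rfl⟩
    exact ⟨fun i hi => c.blocks_pos hi, c.blocks_sum⟩
  · rintro ⟨h, hs⟩
    exact ⟨⟨l, fun {i} hi => h i hi, hs⟩, rfl⟩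

theorem length_le_of_mem_compositionLists {k : ℕ} {l : List ℕ} (hl : l ∈ compositionLists k) :
    l.length ≤ k := by
  obtain ⟨h, rfl⟩ := mem_compositionLists.mp hl
  exact List.length_le_sum_of_one_le l h

/-- The pairs of lists whose concatenation is `l`. -/
def splittings (l : List ℕ) : Finset (List ℕ × List ℕ) :=
  (Finset.range (l.length + 1)).image fun i => (l.take i, l.drop i)

theorem mem_splittings {l : List ℕ} {p : List ℕ × List ℕ} :
    p ∈ splittings l ↔ p.1 ++ p.2 = l := by
  simp only [splittings, Finset.mem_image, Finset.mem_range]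
  constructor
  · rintro ⟨i, -, rfl⟩
    exact List.take_append_drop i l
  · rintro rfl
    exact ⟨p.1.length, by simp, by simp⟩

variable {K A : Type*} [Field K] [CommRing A] [Algebra K A]

/-- The convolution of functions on lists, with respect to concatenation. -/
def convolution (f g : List ℕ → K) (l : List ℕ) : K :=
  ∑ p ∈ splittings l, f p.1 * g p.2

/-- The power series whose `k`-th coefficient is `∑ f(𝐧) x_{n₁} ⋯ x_{n_s}`, over the compositions
`𝐧 = (n₁, …, n_s)` of `k`. -/
noncomputable def listSeries (x : ℕ → A) (f : List ℕ → K) : A⟦X⟧ :=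
  PowerSeries.mk fun k => ∑ l ∈ compositionLists k, f l • (l.map x).prod

theorem coeff_listSeries (x : ℕ → A) (f : List ℕ → K) (k : ℕ) :
    coeff k (listSeries x f) = ∑ l ∈ compositionLists k, f l • (l.map x).prod :=
  PowerSeries.coeff_mk _ _

theorem listSeries_congr (x : ℕ → A) {f g : List ℕ → K} (h : ∀ l, (∀ i ∈ l, 0 < i) → f l = g l) :
    listSeries x f = listSeries x g := by
  ext k
  rw [coeff_listSeries, coeff_listSeries]
  exact Finset.sum_congr rfl fun l hl => by rw [h l (mem_compositionLists.mp hl).1]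

theorem listSeries_add (x : ℕ → A) (f g : List ℕ → K) :
    listSeries x (f + g) = listSeries x f + listSeries x g := by
  ext k
  simp [coeff_listSeries, add_smul, Finset.sum_add_distrib]

/-- Monomials multiply under concatenation. A pair of lists determines its two degrees as sums, so
pairs of compositions of `i` and `j` with `i + j = k` are the same as compositions of `k` with a
chosen cut. -/
theorem listSeries_convolution (x : ℕ → A) (f g : List ℕ → K) :
    listSeries x (convolution f g) = listSeries x f * listSeries x g := by
  ext k
  rw [coeff_mul]
  simp only [coeff_listSeries, convolution, Finset.sum_smul, Finset.sum_mul_sum,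
    ← Finset.sum_product']
  rw [Finset.sum_sigma', Finset.sum_sigma']
  refine Finset.sum_bij' (fun p _ => ⟨(p.2.1.sum, p.2.2.sum), p.2⟩)
    (fun p _ => ⟨p.2.1 ++ p.2.2, p.2⟩) ?_ ?_ ?_ ?_ ?_
  · rintro ⟨l, a, b⟩ h
    simp only [Finset.mem_sigma, mem_splittings, mem_compositionLists] at h
    obtain ⟨⟨h₁, h₂⟩, rfl⟩ := h
    simp only [Finset.mem_sigma, Finset.mem_product, mem_compositionLists]
    exact ⟨by simpa using h₂, ⟨fun i hi => h₁ i (by simp [hi]), trivial⟩,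
      fun i hi => h₁ i (by simp [hi]), trivial⟩
  · rintro ⟨⟨i, j⟩, a, b⟩ h
    simp only [Finset.mem_sigma, Finset.mem_product, mem_compositionLists] at h
    obtain ⟨h, ⟨ha, rfl⟩, hb, rfl⟩ := h
    simp only [Finset.mem_sigma, mem_splittings, mem_compositionLists, and_true]
    refine ⟨fun i hi => ?_, by simpa using h⟩
    rcases List.mem_append.mp hi with hi | hi
    exacts [ha i hi, hb i hi]
  · rintro ⟨l, a, b⟩ h
    simp only [Finset.mem_sigma, mem_splittings] at h
    obtain ⟨-, rfl⟩ := h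
    rfl
  · rintro ⟨⟨i, j⟩, a, b⟩ h
    simp only [Finset.mem_sigma, Finset.mem_product, mem_compositionLists] at h
    obtain ⟨-, ⟨-, rfl⟩, -, rfl⟩ := h
    rfl
  · rintro ⟨l, a, b⟩ h
    simp only [Finset.mem_sigma, mem_splittings] at h
    obtain ⟨-, rfl⟩ := h
    simp [smul_smul, mul_comm]

theorem listSeries_ite_nil (x : ℕ → A) :
    listSeries x (fun l => if l = [] then (1 : K) else 0) = 1 := by
  ext k
  rw [coeff_listSeries, coeff_one]
  simp only [ite_smul, one_smul, zero_smul, Finset.sum_ite_eq', mem_compositionLists]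
  simp [eq_comm]

/-- The sum of `∏ f(𝐧ⁱ)` over the decompositions of a list into `t` nonempty lists `𝐧ⁱ`. -/
def splitSum (f : List ℕ → K) (t : ℕ) (l : List ℕ) : K :=
  ∑ p ∈ split l with p.length = t, (p.map f).prod

theorem splitSum_zero (f : List ℕ → K) (l : List ℕ) :
    splitSum f 0 l = if l = [] then 1 else 0 := by
  have h : (split l).filter (fun p => p.length = 0) = if l = [] then {[]} else ∅ := by
    ext p
    split_ifs with hl
    · subst hl
      simp only [Finset.mem_filter, mem_split, List.length_eq_zero_iff, Finset.mem_singleton]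
      constructor
      · exact fun h => h.2
      · rintro rfl; simp
    · simp only [Finset.mem_filter, mem_split, List.length_eq_zero_iff, Finset.notMem_empty,
        iff_false]
      rintro ⟨⟨h, -⟩, rfl⟩
      exact hl h.symm
  rw [splitSum, h]
  split_ifs <;> simp

/-- Peel off the first block. Setting the weight to zero on `[]` encodes that this block is
nonempty. -/
theorem splitSum_succ (f : List ℕ → K) (t : ℕ) (l : List ℕ) :
    splitSum f (t + 1) l =
      convolution (fun q => if q = [] then 0 else f q) (splitSum f t) l := by
  simp only [splitSum, convolution, ite_mul, zero_mul]
  have h : ∀ p : List ℕ × List ℕ, (if p.1 = [] then 0 else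
      f p.1 * ∑ q ∈ split p.2 with q.length = t, (q.map f).prod) =
      ∑ q ∈ split p.2 with (p.1 ≠ [] ∧ q.length = t), f p.1 * (q.map f).prod := by
    intro p
    split_ifs with hp
    · simp [hp]
    · simp [hp, Finset.mul_sum]
  simp only [h]
  rw [Finset.sum_sigma']
  -- The default of `headD` plays no role: a decomposition into `t + 1` blocks has a first block.
  refine Finset.sum_bij' (fun p _ => ⟨(p.headD [], p.tail.flatten), p.tail⟩)
    (fun p _ => p.1.1 :: p.2) ?_ ?_ ?_ ?_ ?_
  · rintro (_ | ⟨a, p⟩) h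
    · simp at h
    · simp only [Finset.mem_filter, mem_split, List.flatten_cons, List.mem_cons,
        List.length_cons, forall_eq_or_imp] at h
      simp only [Finset.mem_sigma, mem_splittings, Finset.mem_filter, mem_split]
      exact ⟨h.1.1, ⟨trivial, h.1.2.2⟩, h.1.2.1, by simpa using h.2⟩
  · rintro ⟨⟨a, b⟩, q⟩ h
    simp only [Finset.mem_sigma, mem_splittings, Finset.mem_filter, mem_split] at h
    obtain ⟨rfl, ⟨rfl, h₁⟩, h₂, h₃⟩ := h
    simp only [Finset.mem_filter, mem_split, List.flatten_cons, List.mem_cons,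
        List.length_cons, forall_eq_or_imp]
    exact ⟨⟨trivial, h₂, h₁⟩, by omega⟩
  · rintro (_ | ⟨a, p⟩) h
    · simp at h
    · rfl
  · rintro ⟨⟨a, b⟩, q⟩ h
    simp only [Finset.mem_sigma, Finset.mem_filter, mem_split] at h
    obtain ⟨-, ⟨rfl, -⟩, -⟩ := h
    rfl
  · rintro (_ | ⟨a, p⟩) h
    · simp at h
    · simp

theorem splitSum_eq_zero_of_length_lt (f : List ℕ → K) {t : ℕ} {l : List ℕ} (h : l.length < t) :
    splitSum f t l = 0 := by
  rw [splitSum, Finset.filter_false_of_mem, Finset.sum_empty]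
  rintro p hsplit rfl
  obtain ⟨rfl, hp⟩ := (mem_split _ _).mp hsplit
  rw [List.length_flatten] at h
  have := List.length_le_sum_of_one_le (p.map List.length) (by
    intro i hi
    obtain ⟨q, hq, rfl⟩ := List.mem_map.mp hi
    exact List.length_pos_iff.mpr (hp q hq))
  rw [List.length_map] at this
  omega

theorem listSeries_splitSum (x : ℕ → A) (f : List ℕ → K) (t : ℕ) :
    listSeries x (splitSum f t) = listSeries x (fun q => if q = [] then 0 else f q) ^ t := by
  induction t with
  | zero =>
    rw [pow_zero, ← listSeries_ite_nil (K := K) x]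
    exact congrArg _ (funext (splitSum_zero f))
  | succ t ih =>
    rw [pow_succ', ← ih, ← listSeries_convolution]
    exact congrArg _ (funext (splitSum_succ f t))

theorem listSeries_eq_one_add (x : ℕ → A) (f : List ℕ → K) (hf : f [] = 1) :
    listSeries x f = 1 + listSeries x (fun q => if q = [] then 0 else f q) := by
  rw [← listSeries_ite_nil (K := K) x, ← listSeries_add]
  refine listSeries_congr x fun l _ => ?_
  by_cases h : l = [] <;> simp [h, hf]

/-- The binomial theorem for `(1 + u)^m`, where `u` is the part of the series on nonempty lists and
`u^t` is the series of `splitSum f t`. The assumption `k ≠ 0` excludes the empty list, hence the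
term `t = 0`. -/
theorem coeff_listSeries_pow (x : ℕ → A) (f : List ℕ → K) (hf : f [] = 1) (m k : ℕ)
    (hk : k ≠ 0) :
    coeff k (listSeries x f ^ m) = ∑ l ∈ compositionLists k,
      (∑ t ∈ Finset.Icc 1 l.length, (m.choose t : K) * splitSum f t l) • (l.map x).prod := by
  rw [listSeries_eq_one_add x f hf, add_comm, add_pow]
  simp only [one_pow, mul_one, ← listSeries_splitSum, map_sum]
  have h : ∀ t, coeff k (listSeries x (splitSum f t) * (m.choose t : A⟦X⟧)) =
      ∑ l ∈ compositionLists k, ((m.choose t : K) * splitSum f t l) • (l.map x).prod := by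
    intro t
    rw [mul_comm, ← nsmul_eq_mul, map_nsmul, coeff_listSeries, Finset.smul_sum]
    refine Finset.sum_congr rfl fun l _ => ?_
    rw [mul_smul, Nat.cast_smul_eq_nsmul]
  simp only [h]
  rw [Finset.sum_comm]
  refine Finset.sum_congr rfl fun l hl => ?_
  rw [← Finset.sum_smul]
  congr 1
  have hl0 : l ≠ [] := by
    rintro rfl
    exact hk (mem_compositionLists.mp hl).2.symm
  have h₁ : ∀ t ∉ Finset.range (m + 1), (m.choose t : K) * splitSum f t l = 0 := by
    intro t ht
    rw [Nat.choose_eq_zero_of_lt (by simpa using ht), Nat.cast_zero, zero_mul]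
  have h₂ : ∀ t ∉ Finset.Icc 1 l.length, (m.choose t : K) * splitSum f t l = 0 := by
    intro t ht
    rcases Nat.eq_zero_or_pos t with rfl | h0
    · rw [splitSum_zero, if_neg hl0, mul_zero]
    · rw [splitSum_eq_zero_of_length_lt, mul_zero]
      simp only [Finset.mem_Icc, not_and, not_le] at ht
      exact ht h0
  -- The binomial theorem yields `t ≤ m`, while `α` uses `1 ≤ t ≤ l.length`. The summand vanishes
  -- outside either range, so both sums equal the same `finsum`.
  rw [← finsum_eq_sum_of_support_subset _ (s := Finset.range (m + 1)),
    ← finsum_eq_sum_of_support_subset _ (s := Finset.Icc 1 l.length)]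
  · intro t ht
    by_contra hc
    exact ht (h₂ t hc)
  · intro t ht
    by_contra hc
    exact ht (h₁ t hc)

end WeightedSeries

/-! ### The derivation `d/dX - D` on power series -/

section DifferentialEquation

open PowerSeries

variable {K A : Type*} [Field K] [CommRing A] [Algebra K A]

/-- The derivation of `A⟦X⟧` that applies a derivation of `A` to each coefficient. -/
noncomputable def coeffDerivation (d : Derivation K A A) : Derivation K A⟦X⟧ A⟦X⟧ :=
  Derivation.mk'
    { toFun := fun f => PowerSeries.mk fun n => d (coeff n f)
      map_add' := fun f g => by ext; simp
      map_smul' := fun r f => by ext; simp }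
    fun f g => by
      ext n
      simp only [LinearMap.coe_mk, AddHom.coe_mk, coeff_mk, smul_eq_mul, map_add, coeff_mul,
        map_sum, Derivation.leibniz, Finset.sum_add_distrib]
      congr 1
      rw [← Finset.Nat.sum_antidiagonal_swap]
      rfl

theorem coeff_coeffDerivation (d : Derivation K A A) (f : A⟦X⟧) (n : ℕ) :
    coeff n (coeffDerivation d f) = d (coeff n f) :=
  coeff_mk n fun n => d (coeff n f)

/-- The difference of the derivation `d/dX` and of a derivation applied to the coefficients. -/
noncomputable def derivativeSub (d : Derivation K A A) : Derivation K A⟦X⟧ A⟦X⟧ :=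
  (PowerSeries.derivative A).restrictScalars K - coeffDerivation d

theorem coeff_derivativeSub (d : Derivation K A A) (f : A⟦X⟧) (n : ℕ) :
    coeff n (derivativeSub d f) = coeff (n + 1) f * (n + 1) - d (coeff n f) := by
  rw [derivativeSub, Derivation.sub_apply, map_sub, coeff_coeffDerivation,
    Derivation.restrictScalars_apply, coeff_derivative]

/-- The factors `n + 1` introduced by `d/dX` are integers, which `d` annihilates. -/
theorem derivative_derivativeSub (d : Derivation K A A) (f : A⟦X⟧) :
    PowerSeries.derivative A (derivativeSub d f) =
      derivativeSub d (PowerSeries.derivative A f) := by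
  ext n
  simp only [coeff_derivative, coeff_derivativeSub, sub_mul, Derivation.leibniz, map_add,
    Derivation.map_natCast, Derivation.map_one_eq_zero, smul_eq_mul]
  push_cast
  ring

/-- The coefficient function of the series `∑ j, (∑ k, x_k X^k)^j / j!`. -/
noncomputable def expCoeff (K : Type*) [Field K] (l : List ℕ) : K :=
  1 / (l.length ! : K)

/-- The coefficient function of the mean value `X⁻¹ ∫ exp(∑ k, x_k X^k)`. -/
noncomputable def meanCoeff (K : Type*) [Field K] (l : List ℕ) : K :=
  1 / (l.length ! : K) * (1 / ((l.sum : K) + 1))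

theorem convolution_length_one (j : ℕ) (l : List ℕ) :
    convolution (fun q => if q.length = 1 then (1 : K) else 0)
      (fun q => if q.length = j then 1 else 0) l = if l.length = j + 1 then 1 else 0 := by
  rcases l with _ | ⟨a, l⟩
  · rw [convolution, Finset.sum_eq_zero]
    · simp
    · rintro ⟨p, q⟩ h
      have h := mem_splittings.mp h
      simp only [List.append_eq_nil_iff] at h
      simp [h.1]
  · rw [convolution, Finset.sum_eq_single ([a], l)]
    · simp
    · rintro ⟨p, q⟩ h hne
      have h := mem_splittings.mp h
      simp only [mul_eq_zero, ite_eq_right_iff, one_ne_zero, imp_false]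
      by_contra hc
      simp only [not_or, not_not] at hc
      obtain ⟨b, rfl⟩ := List.length_eq_one_iff.mp hc.1
      simp only [List.singleton_append, List.cons.injEq] at h
      exact hne (by rw [h.1, h.2])
    · intro h
      exact absurd (mem_splittings.mpr rfl) h

/-- The series `∑ k ≥ 1, x_k X^k`. -/
noncomputable def generatingSeries (x : ℕ → A) : A⟦X⟧ :=
  PowerSeries.mk fun k => if k = 0 then 0 else x k

theorem listSeries_length_one (x : ℕ → A) :
    listSeries x (fun q => if q.length = 1 then (1 : K) else 0) = generatingSeries x := by
  ext k
  rw [coeff_listSeries, generatingSeries, coeff_mk]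
  split_ifs with hk
  · refine Finset.sum_eq_zero fun l hl => ?_
    have := length_le_of_mem_compositionLists hl
    rw [if_neg (by omega), zero_smul]
  · rw [Finset.sum_eq_single [k]]
    · simp
    · intro l hl hne
      rw [if_neg, zero_smul]
      intro h
      obtain ⟨b, rfl⟩ := List.length_eq_one_iff.mp h
      exact hne (by simpa using (mem_compositionLists.mp hl).2)
    · intro h
      exact absurd (mem_compositionLists.mpr (by simpa using Nat.pos_of_ne_zero hk)) h

theorem listSeries_length_eq (x : ℕ → A) (j : ℕ) :
    listSeries x (fun q => if q.length = j then (1 : K) else 0) = generatingSeries x ^ j := by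
  induction j with
  | zero => simpa using listSeries_ite_nil (K := K) x
  | succ j ih =>
    rw [pow_succ', ← ih, ← listSeries_length_one (K := K), ← listSeries_convolution]
    exact congrArg _ (funext fun l => (convolution_length_one j l).symm)

/-- The exponential is handled through its truncations: a composition of `n` has at most `n` parts,
so powers `j ≥ N > n` do not reach degree `n`. -/
theorem coeff_listSeries_expCoeff (x : ℕ → A) {n N : ℕ} (h : n < N) :
    coeff n (listSeries x (expCoeff K)) =
      coeff n (∑ j ∈ Finset.range N, (1 / (j ! : K)) • generatingSeries x ^ j) := by
  simp only [← listSeries_length_eq (K := K), map_sum, coeff_smul, coeff_listSeries,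
    Finset.smul_sum]
  rw [Finset.sum_comm]
  refine Finset.sum_congr rfl fun l hl => ?_
  rw [Finset.sum_eq_single l.length]
  · simp [expCoeff]
  · intro j _ hj
    simp [hj.symm]
  · intro hl'
    have := length_le_of_mem_compositionLists hl
    simp only [Finset.mem_range, not_lt] at hl'
    omega

theorem constantCoeff_listSeries (x : ℕ → A) (f : List ℕ → K) (hf : f [] = 1) :
    coeff 0 (listSeries x f) = 1 := by
  rw [coeff_listSeries, Finset.sum_eq_single []]
  · simp [hf]
  · intro l hl hne
    have := length_le_of_mem_compositionLists hl
    exact absurd (List.length_eq_zero_iff.mp (by omega)) hne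
  · intro h
    exact absurd (mem_compositionLists.mpr (by simp)) h

/-- Truncated form of `T (exp b) = exp b * T b`; the derivation lowers the order of truncation by
one. -/
theorem derivation_sum_pow_div_factorial [CharZero K] {B : Type*} [CommRing B] [Algebra K B]
    (T : Derivation K B B) (b : B) (N : ℕ) :
    T (∑ j ∈ Finset.range (N + 1), (1 / (j ! : K)) • b ^ j) =
      (∑ j ∈ Finset.range N, (1 / (j ! : K)) • b ^ j) * T b := by
  rw [Finset.sum_range_succ', map_add]
  simp only [pow_zero, Derivation.map_smul, Derivation.map_one_eq_zero, smul_zero, add_zero,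
    map_sum, Derivation.leibniz_pow, Nat.add_sub_cancel, Finset.sum_mul]
  refine Finset.sum_congr rfl fun j _ => ?_
  rw [← Nat.cast_smul_eq_nsmul K, smul_smul, smul_eq_mul, smul_mul_assoc, Nat.factorial_succ]
  congr 1
  push_cast
  have := Nat.cast_ne_zero (R := K).mpr (Nat.factorial_ne_zero j)
  have := Nat.cast_add_one_ne_zero (R := K) j
  field_simp

/-! ### The flow series and its Bell coefficients -/

section Delta

variable (d : Derivation K A A) (δ : ℕ → A)

/-- The divided generators `δ_n / n!`. -/
noncomputable def divDelta (K : Type*) [Field K] [Algebra K A] (δ : ℕ → A) (n : ℕ) : A :=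
  (1 / (n ! : K)) • δ n

/-- In degree `n ≥ 1` the two contributions are both `δ_{n+1} / n!` and cancel. In degree `0` the
series has no term for `d` to act on, so `δ₁` survives. -/
theorem derivativeSub_generatingSeries [CharZero K] (hd : ∀ n, 1 ≤ n → d (δ n) = δ (n + 1)) :
    derivativeSub d (generatingSeries (divDelta K δ)) = C (δ 1) := by
  ext n
  rw [coeff_derivativeSub, coeff_C, generatingSeries, coeff_mk, coeff_mk,
    if_neg n.succ_ne_zero]
  split_ifs with hn
  · simp [hn, divDelta]
  · rw [divDelta, divDelta, Derivation.map_smul, hd n (Nat.one_le_iff_ne_zero.mpr hn),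
      sub_eq_zero, mul_comm, ← Nat.cast_succ, ← nsmul_eq_mul, ← Nat.cast_smul_eq_nsmul K,
      smul_smul, Nat.factorial_succ]
    congr 1
    push_cast
    have := Nat.cast_ne_zero (R := K).mpr (Nat.factorial_ne_zero n)
    have := Nat.cast_add_one_ne_zero (R := K) n
    field_simp

theorem derivativeSub_listSeries_expCoeff
    [CharZero K] (hd : ∀ n, 1 ≤ n → d (δ n) = δ (n + 1)) :
    derivativeSub d (listSeries (divDelta K δ) (expCoeff K)) =
      C (δ 1) * listSeries (divDelta K δ) (expCoeff K) := by
  ext n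
  -- The left side involves the coefficient of degree `n + 1`, hence `n + 2` terms of the
  -- exponential; the right side involves only degree `n`, where the remaining `n + 1` terms
  -- suffice.
  have h := congrArg (coeff n) (derivation_sum_pow_div_factorial (derivativeSub d)
    (generatingSeries (divDelta K δ)) (n + 1))
  rw [coeff_derivativeSub, ← coeff_listSeries_expCoeff _ (by omega),
    ← coeff_listSeries_expCoeff _ (by omega), derivativeSub_generatingSeries d δ hd,
    mul_comm _ (C (δ 1)), coeff_C_mul, ← coeff_listSeries_expCoeff _ (by omega)] at h
  rw [coeff_derivativeSub, coeff_C_mul, h]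

/-- The series `∫ exp(∑ k, δ_k X^k / k!)`. -/
noncomputable def flowSeries (K : Type*) [Field K] [Algebra K A] (δ : ℕ → A) : A⟦X⟧ :=
  X * listSeries (divDelta K δ) (meanCoeff K)

theorem derivative_flowSeries [CharZero K] :
    PowerSeries.derivative A (flowSeries K δ) = listSeries (divDelta K δ) (expCoeff K) := by
  ext n
  rw [coeff_derivative, flowSeries, coeff_succ_X_mul, coeff_listSeries, coeff_listSeries,
    Finset.sum_mul]
  refine Finset.sum_congr rfl fun l hl => ?_
  rw [mul_comm, ← Nat.cast_succ, ← nsmul_eq_mul, ← Nat.cast_smul_eq_nsmul K, smul_smul]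
  congr 1
  rw [meanCoeff, expCoeff, (mem_compositionLists.mp hl).2]
  have := Nat.cast_add_one_ne_zero (R := K) n
  push_cast
  field_simp

/-- Both sides have derivative `δ₁ exp(∑ δ_k X^k / k!)` and constant term `1`. -/
theorem derivativeSub_flowSeries [CharZero K] (hd : ∀ n, 1 ≤ n → d (δ n) = δ (n + 1)) :
    derivativeSub d (flowSeries K δ) = 1 + C (δ 1) * flowSeries K δ := by
  -- A power series is determined by its derivative and constant term only over a torsion-free ring;
  -- here `A` is a `ℚ`-module through `K`.
  let : Module ℚ A := Module.compHom A (algebraMap ℚ K)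
  have : IsAddTorsionFree A := .of_module_rat A
  refine PowerSeries.derivative.ext ?_ ?_
  · rw [derivative_derivativeSub, derivative_flowSeries, derivativeSub_listSeries_expCoeff d δ hd,
      map_add, Derivation.leibniz, derivative_C, derivative_one, derivative_flowSeries]
    simp
  · rw [← coeff_zero_eq_constantCoeff_apply, coeff_derivativeSub, flowSeries, coeff_succ_X_mul,
      constantCoeff_listSeries _ _ (by simp [meanCoeff])]
    simp

/-- The coefficient of `X^n / n!` in the `m`-th divided power of `flowSeries`. -/
noncomputable def bellCoeff (K : Type*) [Field K] [Algebra K A] (δ : ℕ → A) (n m : ℕ) : A :=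
  ((n ! : K) / (m ! : K)) • coeff n (flowSeries K δ ^ m)

theorem coeff_flowSeries_pow (n m : ℕ) :
    coeff n (flowSeries K δ ^ m) =
      if m ≤ n then coeff (n - m) (listSeries (divDelta K δ) (meanCoeff K) ^ m) else 0 := by
  rw [flowSeries, mul_pow, coeff_X_pow_mul']

theorem bellCoeff_eq_zero_of_lt {n m : ℕ} (h : n < m) : bellCoeff K δ n m = 0 := by
  rw [bellCoeff, coeff_flowSeries_pow, if_neg (by omega), smul_zero]

theorem bellCoeff_zero_right {n : ℕ} (h : n ≠ 0) : bellCoeff K δ n 0 = 0 := by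
  rw [bellCoeff, pow_zero, coeff_one, if_neg h, smul_zero]

theorem bellCoeff_self [CharZero K] (n : ℕ) : bellCoeff K δ n n = 1 := by
  rw [bellCoeff, coeff_flowSeries_pow, if_pos le_rfl, Nat.sub_self,
    div_self (Nat.cast_ne_zero.mpr (Nat.factorial_ne_zero n)), one_smul,
    coeff_zero_eq_constantCoeff_apply, map_pow, ← coeff_zero_eq_constantCoeff_apply,
    constantCoeff_listSeries _ _ (by simp [meanCoeff]), one_pow]

/-- Compare coefficients of `X^n` in `T (φ^(m+1)) = (m+1) φ^m (1 + δ₁ φ)` and multiply by `n! /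
(m+1)!`. -/
theorem bellCoeff_succ_succ [CharZero K] (hd : ∀ n, 1 ≤ n → d (δ n) = δ (n + 1))
    (n m : ℕ) :
    bellCoeff K δ (n + 1) (m + 1) = d (bellCoeff K δ n (m + 1)) + bellCoeff K δ n m +
      ((m + 1 : ℕ) : K) • (δ 1 * bellCoeff K δ n (m + 1)) := by
  have h := congrArg (coeff n) ((derivativeSub d).leibniz_pow (a := flowSeries K δ) (m + 1))
  have hp : flowSeries K δ ^ m * (1 + C (δ 1) * flowSeries K δ) =
      flowSeries K δ ^ m + C (δ 1) * flowSeries K δ ^ (m + 1) := by ring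
  rw [coeff_derivativeSub, derivativeSub_flowSeries d δ hd, Nat.add_sub_cancel, smul_eq_mul, hp,
    map_nsmul, map_add, coeff_C_mul, sub_eq_iff_eq_add, mul_comm, ← Nat.cast_succ, ← nsmul_eq_mul, ← Nat.cast_smul_eq_nsmul K,
    ← Nat.cast_smul_eq_nsmul K] at h
  have hn := Nat.cast_add_one_ne_zero (R := K) n
  have hm := Nat.cast_add_one_ne_zero (R := K) m
  have hm' := Nat.cast_ne_zero (R := K).mpr (Nat.factorial_ne_zero m)
  have e : (((n + 1)! : ℕ) : K) / ((m + 1)! : ℕ) =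
      ((n ! : K) / ((m + 1)! : ℕ)) * ((n + 1 : ℕ) : K) := by
    rw [Nat.factorial_succ n]
    push_cast
    ring
  have e' : ((n ! : K) / ((m + 1)! : ℕ)) * ((m + 1 : ℕ) : K) = (n ! : K) / (m ! : K) := by
    rw [Nat.factorial_succ m]
    push_cast
    field_simp
  rw [bellCoeff, e, mul_smul, h, bellCoeff, bellCoeff, Derivation.map_smul, smul_add, smul_smul,
    e', smul_add, mul_smul_comm, smul_smul, mul_comm ((m + 1 : ℕ) : K), e']
  abel

/-- The factor `X^m` of `φ^m` lowers the degree to `n - m`, nonzero because `m < n`. The product of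
factorials in the denominator comes from the divided generators. -/
theorem bellCoeff_eq_sum {n m : ℕ} (h : m < n) :
    bellCoeff K δ n m = ∑ l ∈ compositionLists (n - m),
      ((n ! : K) / (m ! * (l.map fun i => (i ! : K)).prod) *
        ∑ t ∈ Finset.Icc 1 l.length, (m.choose t : K) * splitSum (meanCoeff K) t l) •
        (l.map δ).prod := by
  rw [bellCoeff, coeff_flowSeries_pow, if_pos h.le,
    coeff_listSeries_pow _ _ (by simp [meanCoeff]) _ _ (by omega), Finset.smul_sum]
  refine Finset.sum_congr rfl fun l _ => ?_
  have hl : ∀ l : List ℕ, (l.map (divDelta K δ)).prod =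
      ((l.map fun i => (i ! : K)).prod)⁻¹ • (l.map δ).prod := by
    intro l
    induction l with
    | nil => simp
    | cons a l ih =>
      simp only [List.map_cons, List.prod_cons, ih, divDelta, smul_mul_smul_comm, mul_inv, one_div]
  rw [hl, smul_smul, smul_smul]
  congr 1
  field_simp

end Delta

end DifferentialEquation

/-! ### The recursion for the coproduct of the generators -/

section Coproduct

variable (K : Type*) [Field K]

/-- The algebra `H¹_CM` is commutative. -/
@[reducible] noncomputable def H1.commRing : CommRing (H1 K) :=
  { (inferInstance : Ring (H1 K)) with
    mul_comm := fun a b => Subtype.ext (H1_mul_comm K a b a.2 b.2) }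

attribute [local instance] H1.commRing

/-- The derivation `a ↦ [X, a]` of `H¹_CM`. -/
noncomputable def H1.adX : Derivation K (H1 K) (H1 K) :=
  Derivation.mk'
    { toFun := fun a => ⟨HCM.X K * a - a * HCM.X K, HCM.commutator_X_mem_H1 K a a.2⟩
      map_add' := fun a b => by
        apply Subtype.ext
        change HCM.X K * ((a : HCM K) + b) - (a + b) * HCM.X K =
          (HCM.X K * a - a * HCM.X K) + (HCM.X K * b - b * HCM.X K)
        noncomm_ring
      map_smul' := fun r a => by
        apply Subtype.ext
        change HCM.X K * (r • (a : HCM K)) - (r • (a : HCM K)) * HCM.X K =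
          r • (HCM.X K * a - a * HCM.X K)
        rw [mul_smul_comm, smul_mul_assoc, smul_sub] }
    fun a b => by
      rw [smul_eq_mul, smul_eq_mul, mul_comm b]
      apply Subtype.ext
      change HCM.X K * ((a : HCM K) * b) - (a * b) * HCM.X K =
        a * (HCM.X K * b - b * HCM.X K) + (HCM.X K * a - a * HCM.X K) * b
      noncomm_ring

theorem H1.coe_adX (a : H1 K) : (H1.adX K a : HCM K) = HCM.X K * a - a * HCM.X K :=
  rfl

theorem H1.adX_delta (n : ℕ) (hn : 1 ≤ n) : H1.adX K (H1.delta K n) = H1.delta K (n + 1) := by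
  apply Subtype.ext
  rw [H1.coe_adX]
  change HCM.X K * HCM.delta K n - HCM.delta K n * HCM.X K = HCM.delta K (n + 1)
  rw [HCM.X_mul_delta K n hn, add_sub_cancel_left]

/-- Only `X ⊗ 1` contributes: `1 ⊗ X` commutes with `a ⊗ 1`, and so does `δ₁ ⊗ Y` because `H¹_CM` is
commutative. -/
theorem comulX_commutator_tmul_one (a : H1 K) :
    comulX K * inclTensor K (a ⊗ₜ 1) - inclTensor K (a ⊗ₜ 1) * comulX K =
      inclTensor K (H1.adX K a ⊗ₜ 1) := by
  rw [inclTensor_tmul, inclTensor_tmul, comulX, H1.coe_adX]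
  simp only [OneMemClass.coe_one, add_mul, mul_add, Algebra.TensorProduct.tmul_mul_tmul, one_mul,
    mul_one, TensorProduct.sub_tmul, H1_mul_comm K _ _ (HCM.delta_mem_H1' K 1) a.2]
  abel

/-- The three summands come from `X ⊗ 1`, `1 ⊗ X` and `δ₁ ⊗ Y`, through `[X, a]`, `[X, δ_m] =
δ_{m+1}` and `[Y, δ_m] = m δ_m`. -/
theorem comulX_commutator_tmul_delta (a : H1 K) (m : ℕ) (hm : 1 ≤ m) :
    comulX K * inclTensor K (a ⊗ₜ H1.delta K m) - inclTensor K (a ⊗ₜ H1.delta K m) * comulX K =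
      inclTensor K (H1.adX K a ⊗ₜ H1.delta K m + a ⊗ₜ H1.delta K (m + 1) +
        ((m : K) • (H1.delta K 1 * a)) ⊗ₜ H1.delta K m) := by
  have hX := HCM.X_mul_delta K m hm
  have hY := HCM.Y_mul_delta K m hm
  have hc : ((H1.delta K 1 * a : H1 K) : HCM K) = HCM.delta K 1 * a := rfl
  have hδ : ∀ k, (H1.delta K k : HCM K) = HCM.delta K k := fun _ => rfl
  rw [map_add, map_add, TensorProduct.smul_tmul, inclTensor_tmul, inclTensor_tmul, inclTensor_tmul,
    inclTensor_tmul, comulX, H1.coe_adX, hc]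
  simp only [Subalgebra.coe_smul, hδ, add_mul, mul_add, Algebra.TensorProduct.tmul_mul_tmul,
    one_mul, mul_one, TensorProduct.sub_tmul, hX, hY, TensorProduct.tmul_add,
    H1_mul_comm K _ _ a.2 (HCM.delta_mem_H1' K 1)]
  abel

variable [CharZero K]

/-- The index is shifted: `comulDelta K n` is the coproduct of `δ_{n+1}`. The last summand, with
coefficient `1`, is `1 ⊗ δ_{n+1}`. -/
theorem comulDelta_eq (n : ℕ) :
    comulDelta K n = inclTensor K (H1.delta K (n + 1) ⊗ₜ 1 + ∑ m ∈ Finset.range (n + 1),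
      bellCoeff K (H1.delta K) (n + 1) (m + 1) ⊗ₜ H1.delta K (m + 1)) := by
  induction n with
  | zero =>
    rw [Finset.sum_range_one, bellCoeff_self]
    rfl
  | succ n ih =>
    -- The recursion for the Bell coefficients, summed over `m`. The ranges agree because
    -- `B_{n+1,n+2} = 0` and `B_{n+1,0} = 0`.
    have hsum : ∑ m ∈ Finset.range (n + 2),
          bellCoeff K (H1.delta K) (n + 2) (m + 1) ⊗ₜ[K] H1.delta K (m + 1) =
        ∑ m ∈ Finset.range (n + 1),
          (H1.adX K (bellCoeff K (H1.delta K) (n + 1) (m + 1)) ⊗ₜ[K] H1.delta K (m + 1) +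
            bellCoeff K (H1.delta K) (n + 1) (m + 1) ⊗ₜ[K] H1.delta K (m + 1 + 1) +
            (((m + 1 : ℕ) : K) • (H1.delta K 1 * bellCoeff K (H1.delta K) (n + 1) (m + 1)))
              ⊗ₜ[K] H1.delta K (m + 1)) := by
      simp only [bellCoeff_succ_succ (H1.adX K) (H1.delta K) (H1.adX_delta K) (n + 1),
        TensorProduct.add_tmul, Finset.sum_add_distrib]
      congr 1
      · congr 1
        · rw [Finset.sum_range_succ, bellCoeff_eq_zero_of_lt _ (by omega), map_zero,
            TensorProduct.zero_tmul, add_zero]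
        · rw [Finset.sum_range_succ', bellCoeff_zero_right _ (by omega),
            TensorProduct.zero_tmul, add_zero]
      · rw [Finset.sum_range_succ, bellCoeff_eq_zero_of_lt _ (by omega), mul_zero, smul_zero,
          TensorProduct.zero_tmul, add_zero]
    rw [comulDelta, ih, hsum, map_add, map_sum, mul_add, add_mul, Finset.mul_sum, Finset.sum_mul,
      add_sub_add_comm, ← Finset.sum_sub_distrib, comulX_commutator_tmul_one,
      H1.adX_delta K _ (by omega), map_add, map_sum]
    congr 1
    exact Finset.sum_congr rfl fun m _ => comulX_commutator_tmul_delta K _ _ (by omega)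

theorem cast_coeffA (p : List (List ℕ)) : (coeffA p : K) = (p.map (meanCoeff K)).prod := by
  induction p with
  | nil => simp [coeffA]
  | cons q p ih =>
    rw [List.map_cons, List.prod_cons, ← ih, coeffA, coeffA, meanCoeff]
    simp only [List.map_cons, List.prod_cons]
    simp only [Rat.cast_mul, Rat.cast_div, Rat.cast_add, Rat.cast_one, Rat.cast_natCast]
    rw [one_div, one_div, one_div, one_div, mul_inv]
    ring

theorem cast_alpha (l : List ℕ) (m : ℕ) : (alpha l m : K) =
    ∑ t ∈ Finset.Icc 1 l.length, (m.choose t : K) * splitSum (meanCoeff K) t l := by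
  simp only [alpha, splitSum, Rat.cast_sum, Rat.cast_mul, Rat.cast_natCast, cast_coeffA]

theorem H1.comul_delta (n : ℕ) (hn : 1 ≤ n) :
    H1.comul K (H1.delta K n) = H1.delta K n ⊗ₜ 1 + 1 ⊗ₜ H1.delta K n +
      ∑ m ∈ Finset.Ico 1 n, bellCoeff K (H1.delta K) n m ⊗ₜ H1.delta K m := by
  obtain ⟨n, rfl⟩ := Nat.exists_eq_add_of_le' hn
  apply inclTensor_injective K
  rw [inclTensor_comul]
  change HCM.comul K (HCM.delta K (n + 1)) = _
  rw [HCM.comul_delta, Nat.add_sub_cancel, comulDelta_eq, Finset.sum_range_succ, bellCoeff_self,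
    Finset.sum_Ico_eq_sum_range, Nat.add_sub_cancel]
  simp only [add_comm 1]
  congr 1
  abel

end Coproduct

/-! ### Reindexing by compositions and conclusion -/

/-- Detach the last part `m` of a composition. Having at least two parts means that the remaining
list is nonempty, equivalently `m < n`; the default `0` is therefore never taken. -/
theorem sum_composition_two_le_length {M : Type*} [AddCommMonoid M] (n : ℕ)
    (F : List ℕ → ℕ → M) :
    ∑ c : Composition n with 2 ≤ c.length, F c.blocks.dropLast (c.blocks.getLastD 0) =
      ∑ m ∈ Finset.Ico 1 n, ∑ l ∈ compositionLists (n - m), F l m := by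
  have key : ∀ l : List ℕ, l ≠ [] → l.dropLast ++ [l.getLastD 0] = l := by
    intro l hl
    rw [List.getLastD_eq_getLast?, List.getLast?_eq_getLast_of_ne_nil hl]
    exact List.dropLast_append_getLast hl
  rw [Finset.sum_sigma']
  refine Finset.sum_bij (fun c _ => ⟨c.blocks.getLastD 0, c.blocks.dropLast⟩) ?_ ?_ ?_ ?_
  · intro c hc
    have hlen : 2 ≤ c.blocks.length := by simpa [Composition.length] using hc
    have hne : c.blocks ≠ [] := List.length_pos_iff.mp (by omega)
    have hc := key _ hne
    have hpos : ∀ i ∈ c.blocks, 0 < i := fun i hi => c.blocks_pos hi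
    have hsum := c.blocks_sum
    have hlen' : c.blocks.dropLast.length ≠ 0 := by rw [List.length_dropLast]; omega
    rw [← hc] at hpos hsum
    rw [List.sum_append, List.sum_singleton] at hsum
    have h₁ : ∀ i ∈ c.blocks.dropLast, 0 < i := fun i hi => hpos i (by simp [hi])
    have h₂ := hpos (c.blocks.getLastD 0) (by simp)
    have h₃ := List.length_le_sum_of_one_le _ h₁
    simp only [Finset.mem_sigma, Finset.mem_Ico, mem_compositionLists]
    exact ⟨⟨h₂, by omega⟩, h₁, by omega⟩
  · intro c hc c' hc' h
    have hlen : 2 ≤ c.blocks.length := by simpa [Composition.length] using hc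
    have hlen' : 2 ≤ c'.blocks.length := by simpa [Composition.length] using hc'
    simp only [Sigma.mk.injEq, heq_eq_eq] at h
    apply Composition.ext
    rw [← key _ (List.length_pos_iff.mp (by omega : 0 < c.blocks.length)),
      ← key _ (List.length_pos_iff.mp (by omega : 0 < c'.blocks.length)), h.1, h.2]
  · rintro ⟨m, l⟩ h
    simp only [Finset.mem_sigma, Finset.mem_Ico, mem_compositionLists] at h
    obtain ⟨⟨h₁, h₂⟩, h₃, h₄⟩ := h
    refine ⟨⟨l ++ [m], fun {i} hi => ?_, ?_⟩, ?_, ?_⟩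
    · rcases List.mem_append.mp hi with hi | hi
      · exact h₃ i hi
      · rw [List.mem_singleton.mp hi]; exact h₁
    · rw [List.sum_append, List.sum_singleton]; omega
    · have : l ≠ [] := by
        rintro rfl
        simp only [List.sum_nil] at h₄
        omega
      have := List.length_pos_iff.mpr this
      simp only [Finset.mem_filter, Finset.mem_univ, true_and, Composition.length,
        List.length_append, List.length_singleton]
      omega
    · simp
  · intro c _
    rfl

theorem map_factorial_prod_eq_mul {R : Type*} [CommSemiring R] (n : ℕ) (c : Composition n)
    (hc : 2 ≤ c.length) :
    (c.blocks.map fun i => (i ! : R)).prod =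
      (c.blocks.getLastD 0)! * (c.blocks.dropLast.map fun i => (i ! : R)).prod := by
  have hne : c.blocks ≠ [] := List.length_pos_iff.mp (by change 0 < c.length; omega)
  nth_rw 1 [← List.dropLast_append_getLast hne]
  rw [List.map_append, List.prod_append, List.getLastD_eq_getLast?,
    List.getLast?_eq_getLast_of_ne_nil hne]
  simp [mul_comm]

end ConnesMoscovici

/-- For a composition `c = (n₁, …, n_{s+1})` of `n`, `c.blocks.dropLast` is `(n₁, …, n_s)`,
`c.blocks.getLastD 0` is `n_{s+1}`, and `s ≥ 1` means `2 ≤ c.length`. -/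
theorem theorem2 (K : Type*) [Field K] [CharZero K] (n : ℕ) (hn : 1 ≤ n) :
    ConnesMoscovici.H1.comul K (ConnesMoscovici.H1.delta K n) =
      ConnesMoscovici.H1.delta K n ⊗ₜ[K] 1 + 1 ⊗ₜ[K] ConnesMoscovici.H1.delta K n +
        ∑ c : Composition n with 2 ≤ c.length,
          (((n ! : ℚ) / (c.blocks.map fun i => (i ! : ℚ)).prod *
              ConnesMoscovici.alpha c.blocks.dropLast (c.blocks.getLastD 0) : ℚ) : K) •
            (((c.blocks.dropLast.map (ConnesMoscovici.H1.delta K)).prod) ⊗ₜ[K]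
              ConnesMoscovici.H1.delta K (c.blocks.getLastD 0)) := by
  -- This extends the ring structure already present on `H¹_CM`, so the products in the goal keep
  -- their meaning.
  let := ConnesMoscovici.H1.commRing K
  rw [ConnesMoscovici.H1.comul_delta K n hn]
  congr 1
  let F : List ℕ → ℕ → ConnesMoscovici.H1 K ⊗[K] ConnesMoscovici.H1 K := fun l m =>
    (((n ! : ℚ) / (m ! * (l.map fun i => (i ! : ℚ)).prod) *
      ConnesMoscovici.alpha l m : ℚ) : K) •
        (((l.map (ConnesMoscovici.H1.delta K)).prod) ⊗ₜ[K] ConnesMoscovici.H1.delta K m)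
  trans ∑ m ∈ Finset.Ico 1 n, ∑ l ∈ ConnesMoscovici.compositionLists (n - m), F l m
  · refine Finset.sum_congr rfl fun m hm => ?_
    rw [ConnesMoscovici.bellCoeff_eq_sum _ (Finset.mem_Ico.mp hm).2, TensorProduct.sum_tmul]
    refine Finset.sum_congr rfl fun l _ => ?_
    rw [← ConnesMoscovici.cast_alpha, ← TensorProduct.smul_tmul']
    -- Both products of factorials are casts of one natural number, which lets the cast from `ℚ` to
    -- `K` pass through the coefficient.
    have hcast : ((l.map fun i => (i ! : ℚ)).prod : ℚ) = ((l.map Nat.factorial).prod : ℕ) := by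
      rw [Nat.cast_list_prod, List.map_map]; rfl
    have hcast' : (l.map fun i => (i ! : K)).prod = ((l.map Nat.factorial).prod : ℕ) := by
      rw [Nat.cast_list_prod, List.map_map]; rfl
    simp only [F, hcast, hcast', Rat.cast_mul, Rat.cast_div, Rat.cast_natCast]
  · rw [← ConnesMoscovici.sum_composition_two_le_length]
    refine Finset.sum_congr rfl fun c hc => ?_
    rw [ConnesMoscovici.map_factorial_prod_eq_mul n c (Finset.mem_filter.mp hc).2]
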